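/- Let $d\ge 1$ and $\lambda\ge 0$, and let $\mathcal P$ and $\mathcal P'$ be independent homogeneous Poisson processes in $\mathbb R^d$ of intensities $1$ and $\lambda$, respectively; write $O$ for the origin. The points of $\mathcal P\cup\{O\}$ are called black and those of $\mathcal P'$ red. (Adding $O$ to $\mathcal P$ is the usual way of making $O$ a typical point of $\mathcal P$.) The directed secrecy graph $\vec G_{\rm sec}$ has the black points as its vertices, and a directed edge from a black point $x$ to a black point $y\ne x$ whenever the open ball with centre $x$ and radius $\|x-y\|$ contains no red point. An out-component with root $x$ is a subgraph that has a spanning subtree all of whose edges are directed away from $x$. Let $\theta_{{\bf O},d}(\lambda)$ be the probability that $O$ is the root of an infinite out-component of $\vec G_{\rm sec}$. Then \[ \theta_{{\bf O},d}(\lambda)\le\max\{0,1-\lambda\}. \] -/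

import Mathlib

open MeasureTheory ProbabilityTheory
open scoped NNReal ENNReal

/-- The number of points (possibly `⊤`) of the random set `P` that lie in `B`. -/
noncomputable def pointCount {Ω E : Type*} (P : Ω → Set E) (B : Set E) (ω : Ω) : ℕ∞ :=
  (P ω ∩ B).encard

/-- `P` is a homogeneous Poisson process of intensity `c` in `ℝ^d`, realised as a random set of
points on the probability space `(Ω, μ)`: the number of points in a Borel set `B` of finite
volume is Poisson with mean `c * vol B`, and the numbers of points in finitely many pairwise
disjoint Borel sets are independent. (Almost sure local finiteness follows from the law of the
counts; there are no multiple points since Lebesgue measure is diffuse for `d ≥ 1`.) -/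
structure IsPoissonProcess {Ω : Type*} [MeasurableSpace Ω] (μ : Measure Ω) {d : ℕ}
    (P : Ω → Set (EuclideanSpace ℝ (Fin d))) (c : ℝ≥0) : Prop where
  measurable_count : ∀ B : Set (EuclideanSpace ℝ (Fin d)), MeasurableSet B →
    Measurable (pointCount P B)
  law_count : ∀ B : Set (EuclideanSpace ℝ (Fin d)), MeasurableSet B → volume B ≠ ∞ →
    μ.map (pointCount P B) =
      (poissonMeasure (c * (volume B).toNNReal)).map (fun k : ℕ => (k : ℕ∞))
  indep_count : ∀ (n : ℕ) (B : Fin n → Set (EuclideanSpace ℝ (Fin d))),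
    (∀ i, MeasurableSet (B i)) → Pairwise (fun i j => Disjoint (B i) (B j)) →
      iIndepFun (fun i => pointCount P (B i)) μ

/-- The σ-algebra on `Ω` generated by a random set of points, that is, by all its counts on
Borel sets. -/
@[reducible] noncomputable def pointSigma {Ω E : Type*} [MeasurableSpace E] (P : Ω → Set E) : MeasurableSpace Ω :=
  ⨆ (B : Set E) (_ : MeasurableSet B), MeasurableSpace.comap (pointCount P B) inferInstance

/-- Two random sets of points are independent. -/
def IndepPoints {Ω E : Type*} [MeasurableSpace Ω] [MeasurableSpace E] (μ : Measure Ω)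
    (P P' : Ω → Set E) : Prop :=
  Indep (pointSigma P) (pointSigma P') μ

/-- The directed secrecy graph on the set `V` of black points with the set `R` of red points:
there is an edge from `x` to `y ≠ x` if the open ball centred at `x` of radius `‖x - y‖`
contains no red point. -/
def secrecyGraph {d : ℕ} (V R : Set (EuclideanSpace ℝ (Fin d))) : Digraph V where
  Adj x y := x ≠ y ∧
    ∀ z ∈ R, z ∉ Metric.ball (x : EuclideanSpace ℝ (Fin d))
      ‖(x : EuclideanSpace ℝ (Fin d)) - (y : EuclideanSpace ℝ (Fin d))‖

/-- `T` is (the edge set of) a tree with vertex set `S` all of whose edges are directed away from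
the root `r`: each vertex of `S` can be reached from `r` along edges of `T`, the root has no
parent, and no vertex has two parents. -/
structure IsOutTree {V : Type*} (T : Digraph V) (S : Set V) (r : V) : Prop where
  root_mem : r ∈ S
  mem_of_adj : ∀ x y, T.Adj x y → x ∈ S ∧ y ∈ S
  reach : ∀ x ∈ S, Relation.ReflTransGen T.Adj r x
  root_no_parent : ∀ x, ¬ T.Adj x r
  parent_unique : ∀ x y z, T.Adj x z → T.Adj y z → x = y

/-- The subgraph of `G` with vertex set `S` and edge set `H` is an out-component of `G` with root
`r`: it has a spanning subtree all of whose edges are directed away from `r`. -/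
structure IsOutComponent {V : Type*} (G : Digraph V) (S : Set V) (H : Digraph V) (r : V) :
    Prop where
  adj_of_adj : ∀ x y, H.Adj x y → G.Adj x y
  mem_of_adj : ∀ x y, H.Adj x y → x ∈ S ∧ y ∈ S
  exists_tree : ∃ T : Digraph V, (∀ x y, T.Adj x y → H.Adj x y) ∧ IsOutTree T S r

/-- The digraph `G` has an infinite out-component with root `r`. -/
def HasInfiniteOutComponent {V : Type*} (G : Digraph V) (r : V) : Prop :=
  ∃ (S : Set V) (H : Digraph V), S.Infinite ∧ IsOutComponent G S H r

/-- The out-percolation probability: the probability that the origin, added to the black points,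
is the root of an infinite out-component of the directed secrecy graph. -/
noncomputable def outPercolationProb {Ω : Type*} [MeasurableSpace Ω] (μ : Measure Ω) {d : ℕ}
    (P P' : Ω → Set (EuclideanSpace ℝ (Fin d))) : ℝ :=
  μ.real {ω | HasInfiniteOutComponent (secrecyGraph (insert 0 (P ω)) (P' ω))
    ⟨0, Set.mem_insert 0 (P ω)⟩}

/-! Explore outwards from the origin. Call a revealed black point active until its nearest red point
is known. Repeatedly take an active point `x` and reveal the nearest unrevealed point: it is black
or red with odds `1 : lam`, whatever was seen before. A black point adds at most one active point. A
red one retires `x`, since all out-neighbours of `x` are then revealed. If no active point is left,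
everything reachable from the origin has been revealed. So the number of active points is dominated
by a walk started at `1`, and an infinite out-component forces it to avoid `0` forever. Gambler's
ruin bounds that probability by `max 0 (1 - lam)` (`le_max_of_forall_le_walkSurvival`).

To avoid conditioning on a random explored region, the exploration is run on grid cells in a ball.
Restricted to at most one point per cell, the cells are independent sites, empty, black or red, and
`measureReal_survives_le_prod_mul` is a finite induction over unexplored cells. For almost every
percolating configuration, large balls and then fine grids give a surviving discrete configuration
(`eventually_mem_survivalEvent`), and `measure_le_of_ae_eventually` transfers the bound. The grid
reproduces only strict inequalities between distances, so ties must first be excluded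
(`ae_dist_ne_dist`). -/

/-! ### The gambler's ruin walk -/

/-- The probability that the walk on `ℕ` started at `s`, which steps up with probability
`1 / (1 + lam)` and down with probability `lam / (1 + lam)`, does not visit `0` up to time `n`. -/
noncomputable def walkSurvival (lam : ℝ) : ℕ → ℕ → ℝ
  | _, 0 => 0
  | 0, _ + 1 => 1
  | n + 1, s + 1 => (walkSurvival lam n (s + 2) + lam * walkSurvival lam n s) / (1 + lam)

section Walk

variable {lam : ℝ}

lemma walkSurvival_zero_right (lam : ℝ) (n : ℕ) : walkSurvival lam n 0 = 0 := by
  cases n <;> simp [walkSurvival]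

lemma walkSurvival_succ_succ (lam : ℝ) (n s : ℕ) : walkSurvival lam (n + 1) (s + 1) =
    (walkSurvival lam n (s + 2) + lam * walkSurvival lam n s) / (1 + lam) := by
  simp [walkSurvival]

lemma walkSurvival_nonneg (h : 0 ≤ lam) (n s : ℕ) : 0 ≤ walkSurvival lam n s := by
  induction n generalizing s with
  | zero => cases s <;> simp [walkSurvival]
  | succ n ih =>
    cases s with
    | zero => simp [walkSurvival]
    | succ s =>
      rw [walkSurvival_succ_succ]
      have := ih s
      have := ih (s + 2)
      positivity

lemma walkSurvival_le_one (h : 0 ≤ lam) (n s : ℕ) : walkSurvival lam n s ≤ 1 := by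
  induction n generalizing s with
  | zero => cases s <;> simp [walkSurvival]
  | succ n ih =>
    cases s with
    | zero => simp [walkSurvival]
    | succ s =>
      rw [walkSurvival_succ_succ, div_le_one (by positivity)]
      have h1 := mul_le_mul_of_nonneg_left (ih s) h
      have h2 := ih (s + 2)
      linarith

/-- Lets an upper bound on the number of active sites stand in for that number. -/
lemma walkSurvival_monotone (h : 0 ≤ lam) (n : ℕ) : Monotone (walkSurvival lam n) := by
  refine monotone_nat_of_le_succ fun s => ?_
  induction n generalizing s with
  | zero => cases s <;> simp [walkSurvival]
  | succ n ih =>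
    cases s with
    | zero => rw [walkSurvival_zero_right]; exact walkSurvival_nonneg h _ _
    | succ s =>
      rw [walkSurvival_succ_succ, walkSurvival_succ_succ]
      have h1 := mul_le_mul_of_nonneg_left (ih s) h
      have h2 := ih (s + 2)
      gcongr

lemma walkSurvival_antitone (h : 0 ≤ lam) (s : ℕ) :
    Antitone fun n => walkSurvival lam n s := by
  refine antitone_nat_of_succ_le fun n => ?_
  induction n generalizing s with
  | zero =>
    cases s with
    | zero => simp [walkSurvival]
    | succ s => exact (walkSurvival_le_one h _ _).trans (by simp [walkSurvival])
  | succ n ih =>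
    cases s with
    | zero => simp [walkSurvival_zero_right]
    | succ s =>
      rw [walkSurvival_succ_succ _ (n + 1), walkSurvival_succ_succ _ n]
      have h1 := mul_le_mul_of_nonneg_left (ih s) h
      have h2 := ih (s + 2)
      exact div_le_div_of_nonneg_right (add_le_add h2 h1) (by positivity)

/-- Gambler's ruin: the probability that the walk started at `1` survives forever is at most
`max 0 (1 - lam)`. -/
lemma le_max_of_forall_le_walkSurvival (h : 0 ≤ lam) {c : ℝ}
    (hc : ∀ n, c ≤ walkSurvival lam n 1) : c ≤ max 0 (1 - lam) := by
  set g : ℕ → ℝ := fun s => ⨅ n, walkSurvival lam n s with hg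
  have hbdd (s) : BddBelow (Set.range fun n => walkSurvival lam n s) :=
    ⟨0, by rintro _ ⟨n, rfl⟩; exact walkSurvival_nonneg h n s⟩
  have hlim (s) : Filter.Tendsto (fun n => walkSurvival lam n s) Filter.atTop (nhds (g s)) :=
    tendsto_atTop_ciInf (walkSurvival_antitone h s) (hbdd s)
  have hg0 : g 0 = 0 := by simp [hg, walkSurvival_zero_right]
  have hg1 (s) : g s ≤ 1 := (ciInf_le (hbdd s) 0).trans (walkSurvival_le_one h _ _)
  have hrec (s) : g (s + 1) = (g (s + 2) + lam * g s) / (1 + lam) := by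
    refine tendsto_nhds_unique ((Filter.tendsto_add_atTop_iff_nat 1).2 (hlim (s + 1))) ?_
    simp only [walkSurvival_succ_succ]
    exact ((hlim _).add ((hlim _).const_mul _)).div_const _
  -- The recursion multiplies successive increments of `g` by `lam`.
  have hdiff (s) : g (s + 1) - g s = g 1 * lam ^ s := by
    induction s with
    | zero => simp [hg0]
    | succ s ih =>
      have := hrec s
      rw [eq_div_iff (by positivity)] at this
      rw [pow_succ]
      linear_combination lam * ih - this
  have hsum (s) : g s = g 1 * ∑ k ∈ Finset.range s, lam ^ k := by
    induction s with
    | zero => simp [hg0]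
    | succ s ih => rw [Finset.sum_range_succ, mul_add, ← ih, ← hdiff]; ring
  have hcg : c ≤ g 1 := le_ciInf hc
  refine hcg.trans ?_
  -- Boundedness of `g` against the growth of the geometric sums is what limits `g 1`.
  have hb (s) := (hsum s).symm.trans_le (hg1 s)
  have hgnn : 0 ≤ g 1 := le_ciInf fun n => walkSurvival_nonneg h n 1
  rcases lt_or_ge lam 1 with h1 | h1
  · refine le_max_of_le_right ?_
    have ht : Filter.Tendsto (fun s : ℕ => g 1 * ∑ k ∈ Finset.range s, lam ^ k) Filter.atTop
        (nhds (g 1 * (1 - lam)⁻¹)) :=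
      ((hasSum_geometric_of_lt_one h h1).tendsto_sum_nat).const_mul _
    have := le_of_tendsto' ht hb
    have hpos : 0 < 1 - lam := by linarith
    rwa [← div_eq_mul_inv, div_le_one hpos] at this
  · refine le_max_of_le_left ?_
    by_contra! hpos
    obtain ⟨s, hs⟩ := exists_nat_gt (1 / g 1)
    rw [div_lt_iff₀ hpos] at hs
    have : (s : ℝ) ≤ ∑ k ∈ Finset.range s, lam ^ k := by
      have := Finset.card_nsmul_le_sum (Finset.range s) (fun k => lam ^ k) 1
        (fun k _ => one_le_pow₀ h1)
      simpa using this
    have := mul_le_mul_of_nonneg_left this hgnn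
    have := hb s
    linarith

end Walk

/-! ### Exploration of a finite random configuration

The sites are the elements of a finite type `I`, and a configuration `t : I → Option Bool` makes
each of them empty (`none`), black (`some true`) or red (`some false`). The root, which is black,
is represented by `none : Option I`. The value `ρ x y` is the distance from `x` to `y`. -/

section Exploration

variable {I : Type*}

/-- Among the explored sites `Q` there is a red one such that all sites closer to `x` have been
explored. -/
def IsRetired (ρ : Option I → I → ℝ) (t : I → Option Bool) (Q : Finset I) (x : Option I) : Prop :=
  ∃ z ∈ Q, t z = some false ∧ ∀ y, ρ x y < ρ x z → y ∈ Q

/-- The explored sites that are not empty. -/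
def occupiedSites (t : I → Option Bool) (Q : Finset I) : Finset I :=
  {i ∈ Q | t i ≠ none}

/-- The evidence for retirement lies inside `Q`, so retirement is permanent. -/
lemma IsRetired.mono {ρ : Option I → I → ℝ} {t t' : I → Option Bool} {Q Q' : Finset I}
    {x : Option I} (h : IsRetired ρ t Q x) (hQ : Q ⊆ Q') (ht : ∀ i ∈ Q, t' i = t i) :
    IsRetired ρ t' Q' x := by
  obtain ⟨z, hz, hzr, hy⟩ := h
  exact ⟨z, hQ hz, (ht z hz).trans hzr, fun y hlt => hQ (hy y hlt)⟩

lemma occupiedSites_congr {t t' : I → Option Bool} {Q : Finset I} (h : ∀ i ∈ Q, t' i = t i) :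
    occupiedSites t' Q = occupiedSites t Q :=
  Finset.filter_congr fun i hi => by rw [h i hi]

variable [Fintype I]

open Classical in
/-- The black explored sites, including the root, that are not retired. -/
noncomputable def activeSites (ρ : Option I → I → ℝ) (t : I → Option Bool) (Q : Finset I) :
    Finset (Option I) :=
  {x | (∀ i, x = some i → i ∈ Q ∧ t i = some true) ∧ ¬ IsRetired ρ t Q x}

/-- There are at least `N` occupied sites, and no exploration of at most `N` of them runs out of
active sites. -/
def Survives (ρ : Option I → I → ℝ) (N : ℕ) (t : I → Option Bool) : Prop :=
  N ≤ (occupiedSites t Finset.univ).card ∧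
    ∀ Q : Finset I, (occupiedSites t Q).card ≤ N → (activeSites ρ t Q).Nonempty

lemma mem_activeSites {ρ : Option I → I → ℝ} {t : I → Option Bool} {Q : Finset I} {x : Option I} :
    x ∈ activeSites ρ t Q ↔
      (∀ i, x = some i → i ∈ Q ∧ t i = some true) ∧ ¬ IsRetired ρ t Q x := by
  simp [activeSites]

lemma activeSites_congr {ρ : Option I → I → ℝ} {t t' : I → Option Bool} {Q : Finset I}
    (h : ∀ i ∈ Q, t' i = t i) : activeSites ρ t' Q = activeSites ρ t Q := by
  ext x
  rw [mem_activeSites, mem_activeSites]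
  refine and_congr (forall_congr' fun i => imp_congr_right fun _ => and_congr_right fun hi => by
    rw [h i hi]) (not_congr ⟨fun hx => hx.mono subset_rfl fun i hi => (h i hi).symm,
      fun hx => hx.mono subset_rfl h⟩)

variable [DecidableEq I]

lemma activeSites_insert_of_ne {ρ : Option I → I → ℝ} {t : I → Option Bool} {Q : Finset I} {j : I}
    (hj : j ∉ Q) {a : Option Bool} (ha : a ≠ some true) :
    activeSites ρ (Function.update t j a) (insert j Q) ⊆ activeSites ρ t Q := by
  have hupd : ∀ i ∈ Q, Function.update t j a i = t i := fun i hi =>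
    Function.update_of_ne (ne_of_mem_of_not_mem hi hj) _ _
  intro x hx
  rw [mem_activeSites] at hx ⊢
  refine ⟨fun i hi => ?_, fun hr => hx.2 (hr.mono (Finset.subset_insert _ _) hupd)⟩
  obtain ⟨h1, h2⟩ := hx.1 i hi
  rcases Finset.mem_insert.1 h1 with rfl | h1
  · simp [ha] at h2
  · exact ⟨h1, hupd i h1 ▸ h2⟩

/-- Only the new site itself can become active; older sites can only retire. -/
lemma activeSites_insert_subset {ρ : Option I → I → ℝ} {t : I → Option Bool} {Q : Finset I} {j : I}
    (hj : j ∉ Q) (a : Option Bool) :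
    activeSites ρ (Function.update t j a) (insert j Q) ⊆ insert (some j) (activeSites ρ t Q) := by
  have hupd : ∀ i ∈ Q, Function.update t j a i = t i := fun i hi =>
    Function.update_of_ne (ne_of_mem_of_not_mem hi hj) _ _
  intro x hx
  rw [Finset.mem_insert]
  by_cases hxj : x = some j
  · exact Or.inl hxj
  right
  rw [mem_activeSites] at hx ⊢
  refine ⟨fun i hi => ?_, fun hr => hx.2 (hr.mono (Finset.subset_insert _ _) hupd)⟩
  obtain ⟨h1, h2⟩ := hx.1 i hi
  rcases Finset.mem_insert.1 h1 with rfl | h1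
  · exact absurd hi hxj
  · exact ⟨h1, hupd i h1 ▸ h2⟩

/-- No unexplored site is strictly closer to `x` than `j`, so a red `j` retires `x`. Ties in `ρ` do
no harm, as retirement concerns strictly closer sites only. -/
lemma activeSites_insert_red {ρ : Option I → I → ℝ} {t : I → Option Bool} {Q : Finset I} {j : I}
    (hj : j ∉ Q) {x : Option I} (hmin : ∀ y ∉ Q, ρ x j ≤ ρ x y) :
    activeSites ρ (Function.update t j (some false)) (insert j Q) ⊆
      (activeSites ρ t Q).erase x := by
  intro y hy
  refine Finset.mem_erase.2 ⟨?_, activeSites_insert_of_ne hj (by simp) hy⟩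
  rintro rfl
  refine (mem_activeSites.1 hy).2 ⟨j, Finset.mem_insert_self _ _, by simp, fun z hz => ?_⟩
  refine Finset.mem_insert_of_mem ?_
  by_contra hzQ
  exact absurd (hmin z hzQ) (not_le.2 hz)

/-- The exploration of a configuration with independent sites, each of which is `lam` times as
likely to be red as to be black, is dominated by the gambler's ruin walk. Here `F i a` is the event
that the site `i` is in the state `a`; other states may exist but are excluded. -/
theorem measureReal_survives_le_prod_mul {Ω : Type*} [MeasurableSpace Ω] (μ : Measure Ω)
    [IsProbabilityMeasure μ] {lam : ℝ} (hlam : 0 ≤ lam) (ρ : Option I → I → ℝ)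
    (F : I → Option Bool → Set Ω) (w : I → Option Bool → ℝ)
    (hF : ∀ (Q : Finset I) (t : I → Option Bool),
      μ.real (⋂ i ∈ Q, F i (t i)) = ∏ i ∈ Q, w i (t i))
    (hw0 : ∀ i a, 0 ≤ w i a) (hw1 : ∀ i, w i none + w i (some true) + w i (some false) ≤ 1)
    (hw : ∀ i, w i (some false) = lam * w i (some true)) (N : ℕ)
    (Q : Finset I) (t : I → Option Bool) (n : ℕ) (hn : (occupiedSites t Q).card + n = N) :
    μ.real {ω | ∃ s : I → Option Bool, (∀ i ∈ Q, s i = t i) ∧ (∀ i, ω ∈ F i (s i)) ∧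
      Survives ρ N s} ≤ (∏ i ∈ Q, w i (t i)) * walkSurvival lam n (activeSites ρ t Q).card := by
  have hW (Q : Finset I) (t : I → Option Bool) : 0 ≤ ∏ i ∈ Q, w i (t i) :=
    Finset.prod_nonneg fun i _ => hw0 _ _
  -- Induction on `n` would not do: revealing an empty site leaves `n` unchanged.
  induction hk : Qᶜ.card using Nat.strong_induction_on generalizing Q t n with
  | _ k ih =>
  rcases (activeSites ρ t Q).eq_empty_or_nonempty with hA | ⟨x, hx⟩
  · refine (measureReal_mono (s₂ := ∅) ?_).trans ?_
    · rintro ω ⟨s, hs, -, -, hsurv⟩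
      -- `Survives` speaks of all explored sets, so it applies to `Q` however `Q` was grown.
      have := hsurv Q (by rw [occupiedSites_congr hs]; omega)
      rw [activeSites_congr hs, hA] at this
      exact absurd this Finset.not_nonempty_empty
    · simp [hA, walkSurvival_zero_right]
  obtain ⟨c, hc⟩ : ∃ c, (activeSites ρ t Q).card = c + 1 :=
    Nat.exists_eq_succ_of_ne_zero (Finset.card_pos.2 ⟨x, hx⟩).ne'
  cases n with
  | zero =>
    rw [hc, walkSurvival, mul_one, ← hF]
    refine measureReal_mono ?_
    rintro ω ⟨s, hs, hω, -⟩
    exact Set.mem_iInter₂.2 fun i hi => hs i hi ▸ hω i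
  | succ n =>
  by_cases hQ : Q = Finset.univ
  · refine (measureReal_mono (s₂ := ∅) ?_).trans ?_
    · rintro ω ⟨s, hs, -, hsurv, -⟩
      rw [← hQ, occupiedSites_congr hs] at hsurv
      omega
    · simpa using mul_nonneg (hW Q t) (walkSurvival_nonneg hlam _ _)
  -- The next site to reveal is an unexplored one nearest to the active site `x`.
  obtain ⟨j, hjQ, hmin⟩ : ∃ j ∉ Q, ∀ y ∉ Q, ρ x j ≤ ρ x y := by
    obtain ⟨j, hj, hmin⟩ := Finset.exists_min_image Qᶜ (ρ x)
      (Finset.nonempty_iff_ne_empty.2 (by simpa using hQ))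
    exact ⟨j, by simpa using hj, fun y hy => hmin y (by simpa using hy)⟩
  set D : Option Bool → Set Ω := fun a => {ω | ∃ s : I → Option Bool,
    (∀ i ∈ insert j Q, s i = Function.update t j a i) ∧ (∀ i, ω ∈ F i (s i)) ∧ Survives ρ N s}
    with hD
  have hupd (a : Option Bool) : ∀ i ∈ Q, Function.update t j a i = t i := fun i hi =>
    Function.update_of_ne (ne_of_mem_of_not_mem hi hjQ) _ _
  have hsplit : {ω | ∃ s : I → Option Bool, (∀ i ∈ Q, s i = t i) ∧ (∀ i, ω ∈ F i (s i)) ∧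
      Survives ρ N s} ⊆ D none ∪ D (some true) ∪ D (some false) := by
    rintro ω ⟨s, hs, hω⟩
    have : ω ∈ D (s j) := by
      refine ⟨s, fun i hi => ?_, hω⟩
      rcases Finset.mem_insert.1 hi with rfl | hi
      · simp
      · rw [hs i hi, hupd _ i hi]
    rcases hsj : s j with _ | _ | _ <;> rw [hsj] at this <;> simp [this]
  have hprod (a : Option Bool) : ∏ i ∈ insert j Q, w i (Function.update t j a i) =
      w j a * ∏ i ∈ Q, w i (t i) := by
    rw [Finset.prod_insert hjQ, Function.update_self]
    exact congrArg _ (Finset.prod_congr rfl fun i hi => by rw [hupd a i hi])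
  have hocc (a : Option Bool) : (occupiedSites (Function.update t j a) (insert j Q)).card =
      (occupiedSites t Q).card + if a = none then 0 else 1 := by
    rw [occupiedSites, Finset.filter_insert, Function.update_self,
      show {i ∈ Q | Function.update t j a i ≠ none} = occupiedSites t Q from
        occupiedSites_congr (hupd a)]
    by_cases ha : a = none
    · rw [if_neg (not_not.2 ha), if_pos ha, add_zero]
    · rw [if_pos ha, if_neg ha]
      exact Finset.card_insert_of_notMem fun h => hjQ (Finset.mem_filter.1 h).1
  have hcard : (insert j Q)ᶜ.card < k := by
    rw [← hk]
    exact Finset.card_lt_card (Finset.compl_ssubset_compl.2 (Finset.ssubset_insert hjQ))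
  have hbound (a : Option Bool) (m b : ℕ)
      (hm : (occupiedSites t Q).card + (if a = none then 0 else 1) + m = N)
      (hb : (activeSites ρ (Function.update t j a) (insert j Q)).card ≤ b) :
      μ.real (D a) ≤ w j a * (∏ i ∈ Q, w i (t i)) * walkSurvival lam m b := by
    have := ih _ hcard (insert j Q) (Function.update t j a) m (by rw [hocc, hm]) rfl
    rw [hprod] at this
    exact this.trans (mul_le_mul_of_nonneg_left (walkSurvival_monotone hlam m hb)
      (mul_nonneg (hw0 _ _) (hW Q t)))
  -- An empty site costs no step of the walk; a black one is a step up, a red one a step down.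
  have h1 := hbound none (n + 1) (c + 1) (by simpa using hn)
    (hc ▸ Finset.card_le_card (activeSites_insert_of_ne hjQ (by simp)))
  have h2 := hbound (some true) n (c + 2) (by simp; omega)
    ((Finset.card_le_card (activeSites_insert_subset hjQ _)).trans
      ((Finset.card_insert_le _ _).trans (by omega)))
  have h3 := hbound (some false) n c (by simp; omega)
    ((Finset.card_le_card (activeSites_insert_red hjQ hmin)).trans
      (by rw [Finset.card_erase_of_mem hx]; omega))
  have hle : μ.real (D none ∪ D (some true) ∪ D (some false)) ≤
      μ.real (D none) + μ.real (D (some true)) + μ.real (D (some false)) :=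
    (measureReal_union_le _ _).trans (by gcongr; exact measureReal_union_le _ _)
  refine (measureReal_mono hsplit).trans (hle.trans ?_)
  have hrec : walkSurvival lam n (c + 2) + lam * walkSurvival lam n c =
      (1 + lam) * walkSurvival lam (n + 1) (c + 1) := by
    rw [walkSurvival_succ_succ]
    field_simp
  rw [hc]
  rw [hw] at h3
  -- An inequality suffices here: mass outside the three states only lowers the probability.
  have h4 := mul_le_mul_of_nonneg_right (hw1 j)
    (mul_nonneg (hW Q t) (walkSurvival_nonneg hlam (n + 1) (c + 1)))
  rw [hw] at h4
  calc _ ≤ w j none * (∏ i ∈ Q, w i (t i)) * walkSurvival lam (n + 1) (c + 1) +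
        w j (some true) * (∏ i ∈ Q, w i (t i)) * walkSurvival lam n (c + 2) +
        lam * w j (some true) * (∏ i ∈ Q, w i (t i)) * walkSurvival lam n c := by gcongr
    _ = (w j none + w j (some true) + lam * w j (some true)) *
        ((∏ i ∈ Q, w i (t i)) * walkSurvival lam (n + 1) (c + 1)) := by
      linear_combination w j (some true) * (∏ i ∈ Q, w i (t i)) * hrec
    _ ≤ _ := by linarith

/-- A configuration with independent sites, each of which is `lam` times as likely to be red as to
be black, survives the exploration of `N` sites with probability at most that of the walk. -/
theorem measureReal_survives_le {Ω : Type*} [MeasurableSpace Ω] (μ : Measure Ω)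
    [IsProbabilityMeasure μ] {lam : ℝ} (hlam : 0 ≤ lam) (ρ : Option I → I → ℝ)
    (F : I → Option Bool → Set Ω) (w : I → Option Bool → ℝ)
    (hF : ∀ (Q : Finset I) (t : I → Option Bool),
      μ.real (⋂ i ∈ Q, F i (t i)) = ∏ i ∈ Q, w i (t i))
    (hw0 : ∀ i a, 0 ≤ w i a) (hw1 : ∀ i, w i none + w i (some true) + w i (some false) ≤ 1)
    (hw : ∀ i, w i (some false) = lam * w i (some true)) (N : ℕ) :
    μ.real {ω | ∃ s : I → Option Bool, (∀ i, ω ∈ F i (s i)) ∧ Survives ρ N s} ≤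
      walkSurvival lam N 1 := by
  have h := measureReal_survives_le_prod_mul μ hlam ρ F w hF hw0 hw1 hw N ∅ (fun _ => none) N
    (by simp [occupiedSites])
  have hA : activeSites ρ (fun _ => none) (∅ : Finset I) ⊆ {none} := by
    intro x hx
    rcases x with _ | i
    · simp
    · simpa using (mem_activeSites.1 hx).1 i rfl
  simp only [Finset.notMem_empty, false_imp_iff, implies_true, true_and, Finset.prod_empty,
    one_mul] at h
  exact h.trans (walkSurvival_monotone hlam N (by simpa using Finset.card_le_card hA))

end Exploration

/-! ### Counts of Poisson processes -/

section Counts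

lemma measurable_pointCount_pointSigma {Ω E : Type*} [MeasurableSpace E] (P : Ω → Set E)
    {B : Set E} (hB : MeasurableSet B) : Measurable[pointSigma P] (pointCount P B) :=
  measurable_iff_comap_le.2 (le_iSup₂_of_le B hB le_rfl)

variable {Ω : Type*} [MeasurableSpace Ω] {μ : Measure Ω} {d : ℕ}
  {P P' : Ω → Set (EuclideanSpace ℝ (Fin d))} {c : ℝ≥0}

lemma IsPoissonProcess.measure_count_eq (hP : IsPoissonProcess μ P c)
    {B : Set (EuclideanSpace ℝ (Fin d))} (hB : MeasurableSet B) (hv : volume B ≠ ∞) (k : ℕ) :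
    μ (pointCount P B ⁻¹' {(k : ℕ∞)}) = poissonMeasure (c * (volume B).toNNReal) {k} := by
  rw [← Measure.map_apply (hP.measurable_count B hB) (measurableSet_singleton _),
    hP.law_count B hB hv, Measure.map_apply (Measurable.of_discrete) (measurableSet_singleton _)]
  congr 1
  ext n
  simp

lemma IsPoissonProcess.ae_finite (hP : IsPoissonProcess μ P c)
    {B : Set (EuclideanSpace ℝ (Fin d))} (hB : MeasurableSet B) (hv : volume B ≠ ∞) :
    ∀ᵐ ω ∂μ, (P ω ∩ B).Finite := by
  have : μ (pointCount P B ⁻¹' {⊤}) = 0 := by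
    rw [← Measure.map_apply (hP.measurable_count B hB) (measurableSet_singleton _),
      hP.law_count B hB hv, Measure.map_apply (Measurable.of_discrete) (measurableSet_singleton _)]
    convert measure_empty (μ := poissonMeasure (c * (volume B).toNNReal))
    ext n
    simp
  refine measure_mono_null (fun ω hω => ?_) this
  simpa [pointCount, Set.encard_eq_top_iff] using hω

/-- This is `1 - exp (-r) ≤ r` with `r` the mean count. -/
lemma IsPoissonProcess.measure_count_ne_zero_le [IsProbabilityMeasure μ]
    (hP : IsPoissonProcess μ P c)
    {B : Set (EuclideanSpace ℝ (Fin d))} (hB : MeasurableSet B) (hv : volume B ≠ ∞) :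
    μ {ω | pointCount P B ω ≠ 0} ≤ c * volume B := by
  have hm : MeasurableSet (pointCount P B ⁻¹' {0}) :=
    hP.measurable_count B hB (measurableSet_singleton _)
  have h0 := hP.measure_count_eq hB hv 0
  rw [poissonMeasure_singleton] at h0
  have : {ω | pointCount P B ω ≠ 0} = (pointCount P B ⁻¹' {0})ᶜ := by ext; simp
  rw [this, prob_compl_eq_one_sub hm]
  rw [Nat.cast_zero] at h0
  rw [h0, tsub_le_iff_left]
  have hr : (c : ℝ≥0∞) * volume B =
      ENNReal.ofReal ((c * (volume B).toNNReal : ℝ≥0) : ℝ) := by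
    rw [ENNReal.ofReal_coe_nnreal, ENNReal.coe_mul, ENNReal.coe_toNNReal hv]
  rw [hr, ← ENNReal.ofReal_add (by positivity) (by positivity), ENNReal.one_le_ofReal]
  have := Real.add_one_le_exp (-((c * (volume B).toNNReal : ℝ≥0) : ℝ))
  simp only [pow_zero, Nat.factorial_zero, Nat.cast_one, mul_one, div_one]
  linarith

/-- The counts of two independent Poisson processes on disjoint sets are jointly independent. -/
lemma measure_biInter_counts_eq_prod {P P' : Ω → Set (EuclideanSpace ℝ (Fin d))} {c c' : ℝ≥0}
    (hP : IsPoissonProcess μ P c) (hP' : IsPoissonProcess μ P' c') (hindep : IndepPoints μ P P')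
    {I : Type*} [Finite I] (B : I → Set (EuclideanSpace ℝ (Fin d)))
    (hB : ∀ i, MeasurableSet (B i)) (hdisj : Pairwise fun i j => Disjoint (B i) (B j))
    (Q : Finset I) (a b : I → ℕ∞) :
    μ (⋂ i ∈ Q, pointCount P (B i) ⁻¹' {a i} ∩ pointCount P' (B i) ⁻¹' {b i}) =
      ∏ i ∈ Q, μ (pointCount P (B i) ⁻¹' {a i}) * μ (pointCount P' (B i) ⁻¹' {b i}) := by
  obtain ⟨n, ⟨e⟩⟩ := Finite.exists_equiv_fin I
  have key {R : Ω → Set (EuclideanSpace ℝ (Fin d))} {c : ℝ≥0} (hR : IsPoissonProcess μ R c)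
      (a : I → ℕ∞) : μ (⋂ i ∈ Q, pointCount R (B i) ⁻¹' {a i}) =
        ∏ i ∈ Q, μ (pointCount R (B i) ⁻¹' {a i}) := by
    have h := (hR.indep_count n (fun k => B (e.symm k)) (fun k => hB _)
      (fun k l hkl => hdisj (e.symm.injective.ne hkl))).precomp e.injective
    simp only [Equiv.symm_apply_apply] at h
    exact h.measure_inter_preimage_eq_mul Q fun i _ => measurableSet_singleton _
  have hm (R : Ω → Set (EuclideanSpace ℝ (Fin d))) (a : I → ℕ∞) :
      MeasurableSet[pointSigma R] (⋂ i ∈ Q, pointCount R (B i) ⁻¹' {a i}) :=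
    MeasurableSet.biInter (Finset.countable_toSet Q) fun i _ =>
      measurable_pointCount_pointSigma R (hB i) (measurableSet_singleton _)
  rw [Finset.prod_mul_distrib, ← key hP, ← key hP', ← (Indep_iff _ _ μ).1 hindep _ _ (hm P a)
    (hm P' b)]
  congr 1
  ext ω
  simp only [Set.mem_iInter, Set.mem_inter_iff, forall_and]

end Counts

/-! ### Cells of a fine grid -/

section Cells

variable {d : ℕ}

/-- The index of the grid cell of side `1 / (m + 1)` that contains `x`. -/
noncomputable def gridIndex (m : ℕ) (x : EuclideanSpace ℝ (Fin d)) : Fin d → ℤ :=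
  fun i => ⌊(m + 1 : ℝ) * x i⌋

/-- The corner of the grid cell with index `k`. -/
noncomputable def gridPoint (m : ℕ) (k : Fin d → ℤ) : EuclideanSpace ℝ (Fin d) :=
  WithLp.toLp 2 fun i => (k i : ℝ) / (m + 1)

/-- A bound for the diameter of the grid cells. -/
noncomputable def gridMesh (d m : ℕ) : ℝ := √d / (m + 1)

/-- The intersection of the grid cell with index `k` with the ball of radius `L`. -/
def gridCell (L m : ℕ) (k : Fin d → ℤ) : Set (EuclideanSpace ℝ (Fin d)) :=
  {x | x ∈ Metric.ball 0 (L : ℝ) ∧ gridIndex m x = k}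

lemma measurable_gridIndex (m : ℕ) :
    Measurable (gridIndex m : EuclideanSpace ℝ (Fin d) → Fin d → ℤ) := by
  refine measurable_pi_lambda _ fun i => Int.measurable_floor.comp ?_
  fun_prop

lemma measurableSet_gridCell (L m : ℕ) (k : Fin d → ℤ) : MeasurableSet (gridCell L m k) :=
  measurableSet_ball.inter (measurable_gridIndex m (measurableSet_singleton k))

lemma volume_gridCell_ne_top (L m : ℕ) (k : Fin d → ℤ) : volume (gridCell L m k) ≠ ∞ :=
  ((measure_mono fun _ hx => hx.1).trans_lt
    (measure_ball_lt_top (x := (0 : EuclideanSpace ℝ (Fin d))) (r := L))).ne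

lemma disjoint_gridCell (L m : ℕ) {k l : Fin d → ℤ} (h : k ≠ l) :
    Disjoint (gridCell L m k) (gridCell L m l) :=
  Set.disjoint_left.2 fun _ hk hl => h (hk.2.symm.trans hl.2)

lemma dist_gridPoint_gridIndex_le (m : ℕ) (x : EuclideanSpace ℝ (Fin d)) :
    dist (gridPoint m (gridIndex m x)) x ≤ gridMesh d m := by
  have hm : (0 : ℝ) < m + 1 := by positivity
  have key (i : Fin d) : dist ((gridPoint m (gridIndex m x)).ofLp i) (x.ofLp i) ≤ 1 / (m + 1) := by
    have h1 := Int.floor_le ((m + 1 : ℝ) * x i)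
    have h2 := (Int.lt_floor_add_one ((m + 1 : ℝ) * x i)).le
    rw [Real.dist_eq, abs_sub_comm, abs_le]
    simp only [gridPoint, gridIndex]
    constructor
    · have : (⌊(m + 1 : ℝ) * x i⌋ : ℝ) / (m + 1) ≤ x i := by rwa [div_le_iff₀' hm]
      have : 0 < 1 / (m + 1 : ℝ) := by positivity
      linarith
    · rw [sub_le_iff_le_add, ← add_div, le_div_iff₀' hm]
      linarith
  rw [EuclideanSpace.dist_eq, gridMesh, Real.sqrt_le_left (by positivity), div_pow,
    Real.sq_sqrt (by positivity)]
  calc _ ≤ ∑ _i : Fin d, (1 / (m + 1 : ℝ)) ^ 2 :=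
        Finset.sum_le_sum fun i _ => pow_le_pow_left₀ dist_nonneg (key i) 2
    _ = _ := by simp; ring

lemma tendsto_gridMesh (d : ℕ) : Filter.Tendsto (gridMesh d) Filter.atTop (nhds 0) := by
  have h := (tendsto_one_div_add_atTop_nhds_zero_nat (𝕜 := ℝ)).const_mul √d
  rw [mul_zero] at h
  exact h.congr fun m => mul_one_div _ _

lemma tendsto_gridPoint_gridIndex (x : EuclideanSpace ℝ (Fin d)) :
    Filter.Tendsto (fun m => gridPoint m (gridIndex m x)) Filter.atTop (nhds x) :=
  tendsto_iff_dist_tendsto_zero.2 (squeeze_zero (fun _ => dist_nonneg)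
    (fun m => dist_gridPoint_gridIndex_le m x) (tendsto_gridMesh d))

lemma finite_gridIndex_image_ball (L m : ℕ) :
    (gridIndex m '' Metric.ball (0 : EuclideanSpace ℝ (Fin d)) (L : ℝ)).Finite := by
  refine (Set.Finite.pi' fun _ : Fin d =>
    Set.finite_Icc (-((m + 1) * L) : ℤ) ((m + 1) * L)).subset ?_
  rintro _ ⟨x, hx, rfl⟩ i
  have h1 : |x i| ≤ L := by
    have := (PiLp.norm_apply_le x i).trans (mem_ball_zero_iff.1 hx).le
    simpa using this
  have hm : (0 : ℝ) < m + 1 := by positivity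
  obtain ⟨h2, h3⟩ := abs_le.1 h1
  refine ⟨Int.le_floor.2 ?_, Int.floor_le_iff.2 ?_⟩
  · push_cast
    nlinarith
  · push_cast
    nlinarith

/-- The indices of the grid cells that meet the ball of radius `L`. -/
abbrev GridIndex (d L m : ℕ) : Type :=
  gridIndex m '' Metric.ball (0 : EuclideanSpace ℝ (Fin d)) (L : ℝ)

noncomputable instance (d L m : ℕ) : Fintype (GridIndex d L m) :=
  (finite_gridIndex_image_ball L m).fintype

end Cells

/-! ### Almost surely there are no ties between distances -/

section Ties

variable {d : ℕ}

/-- The origin and the corners of the cells in `J`. -/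
noncomputable def gridCorners {L m : ℕ} (J : Finset (GridIndex d L m)) :
    Finset (EuclideanSpace ℝ (Fin d)) :=
  open Classical in insert 0 (J.image fun k : GridIndex d L m => gridPoint m k)

/-- The points `z` of the ball for which the distances `dist x y` and `dist x z` almost agree for
some `x, y` among the corners of the cells in `J` and the origin. -/
def tieZone {L m : ℕ} (J : Finset (GridIndex d L m)) : Set (EuclideanSpace ℝ (Fin d)) :=
  Metric.ball 0 (L : ℝ) ∩ ⋃ x ∈ gridCorners J, ⋃ y ∈ gridCorners J,
    {z | |dist x y - dist x z| ≤ 3 * gridMesh d m}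

lemma measurableSet_tieZone {L m : ℕ} (J : Finset (GridIndex d L m)) :
    MeasurableSet (tieZone J) := by
  refine measurableSet_ball.inter (Finset.measurableSet_biUnion _ fun x _ =>
    Finset.measurableSet_biUnion _ fun y _ => IsClosed.measurableSet ?_)
  exact isClosed_le (by fun_prop) continuous_const

lemma volume_tieZone_le {L m : ℕ} (J : Finset (GridIndex d L m)) :
    volume (tieZone J) ≤ volume (Metric.ball (0 : EuclideanSpace ℝ (Fin d)) (L : ℝ)) :=
  measure_mono Set.inter_subset_left

/-- Moving `x` affects both distances and moving `y` only one, whence the `3`. -/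
lemma abs_dist_sub_dist_sub_le (x y z x' y' : EuclideanSpace ℝ (Fin d)) {δ : ℝ}
    (hx : dist x' x ≤ δ) (hy : dist y' y ≤ δ) :
    |(dist x y - dist x z) - (dist x' y' - dist x' z)| ≤ 3 * δ := by
  have h1 := dist_triangle4 x x' y' y
  have h2 := dist_triangle4 x' x y y'
  have h3 := dist_triangle x x' z
  have h4 := dist_triangle x' x z
  rw [dist_comm x x'] at h1 h3
  rw [dist_comm y y'] at h2
  rw [abs_le]
  constructor <;> linarith

/-- The cells that contain a point. -/
noncomputable def hitCells {Ω : Type*} (P : Ω → Set (EuclideanSpace ℝ (Fin d))) (L m : ℕ) (ω : Ω) :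
    Finset (GridIndex d L m) :=
  {k | pointCount P (gridCell L m k) ω ≠ 0}

variable {Ω : Type*} {P : Ω → Set (EuclideanSpace ℝ (Fin d))}

lemma mem_hitCells {L m : ℕ} {ω : Ω} {k : GridIndex d L m} :
    k ∈ hitCells P L m ω ↔ ∃ x ∈ P ω, x ∈ gridCell L m k := by
  rw [hitCells, Finset.mem_filter]
  simp [pointCount, ← Set.nonempty_iff_ne_empty, Set.Nonempty]

/-- Measurability with respect to `pointSigma P`, not just the ambient σ-algebra, is what lets
independence from `P'` be used. -/
lemma measurableSet_hitCells_eq (L m : ℕ) (J : Finset (GridIndex d L m)) :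
    MeasurableSet[pointSigma P] {ω | hitCells P L m ω = J} := by
  have : {ω | hitCells P L m ω = J} =
      ⋂ k : GridIndex d L m, pointCount P (gridCell L m k) ⁻¹' {n | n ≠ 0 ↔ k ∈ J} := by
    ext ω
    simp only [hitCells, Finset.ext_iff, Finset.mem_filter, Finset.mem_univ, true_and,
      Set.mem_iInter, Set.mem_preimage, Set.mem_ofPred_eq]
  rw [this]
  exact MeasurableSet.iInter fun k =>
    measurable_pointCount_pointSigma P (measurableSet_gridCell L m k) (MeasurableSet.of_discrete)

lemma exists_near_mem_gridCorners {L : ℕ} (m : ℕ) {ω : Ω} {x : EuclideanSpace ℝ (Fin d)}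
    (hx : x ∈ insert 0 (P ω)) (hxL : x ∈ Metric.ball 0 (L : ℝ)) :
    ∃ x' ∈ gridCorners (hitCells P L m ω), dist x' x ≤ gridMesh d m := by
  rcases hx with rfl | hx
  · exact ⟨0, by simp [gridCorners], by rw [dist_self, gridMesh]; positivity⟩
  · refine ⟨gridPoint m (gridIndex m x), ?_, dist_gridPoint_gridIndex_le m x⟩
    refine Finset.mem_insert_of_mem (Finset.mem_image.2
      ⟨⟨gridIndex m x, Set.mem_image_of_mem _ hxL⟩, mem_hitCells.2 ⟨x, hx, hxL, rfl⟩, rfl⟩)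

lemma exists_near_of_mem_gridCorners {L m : ℕ} {ω : Ω} {x' : EuclideanSpace ℝ (Fin d)}
    (hx' : x' ∈ gridCorners (hitCells P L m ω)) :
    ∃ x ∈ insert 0 (P ω ∩ Metric.ball 0 (L : ℝ)), dist x' x ≤ gridMesh d m := by
  rcases Finset.mem_insert.1 hx' with rfl | hx'
  · exact ⟨0, by simp, by rw [dist_self, gridMesh]; positivity⟩
  · obtain ⟨k, hk, rfl⟩ := Finset.mem_image.1 hx'
    obtain ⟨x, hx, hxk⟩ := mem_hitCells.1 hk
    refine ⟨x, Or.inr ⟨hx, hxk.1⟩, ?_⟩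
    rw [← hxk.2]
    exact dist_gridPoint_gridIndex_le m x

/-- The zones shrink to finitely many spheres centred at one of the points and through another.
These are null because `1 ≤ d`, and all zones lie in one ball, so the volumes converge. -/
lemma tendsto_volume_tieZone (hd : 1 ≤ d) (L : ℕ) {ω : Ω}
    (hfin : (P ω ∩ Metric.ball 0 (L : ℝ)).Finite) :
    Filter.Tendsto (fun m => volume (tieZone (hitCells P L m ω))) Filter.atTop (nhds 0) := by
  have : Nonempty (Fin d) := ⟨⟨0, hd⟩⟩
  rw [← measure_empty (μ := (volume : Measure (EuclideanSpace ℝ (Fin d))))]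
  refine tendsto_measure_of_ae_tendsto_indicator Filter.atTop MeasurableSet.empty
    (fun m => measurableSet_tieZone _) (measurableSet_ball (x := 0) (ε := (L : ℝ)))
    measure_ball_lt_top.ne (.of_forall fun m => Set.inter_subset_left) ?_
  have hfin' := hfin.insert 0
  have hsph : ∀ᵐ z : EuclideanSpace ℝ (Fin d), ∀ x ∈ insert 0 (P ω ∩ Metric.ball 0 (L : ℝ)),
      ∀ y ∈ insert 0 (P ω ∩ Metric.ball 0 (L : ℝ)), dist x y ≠ dist x z := by
    rw [ae_ball_iff hfin'.countable]
    intro x _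
    rw [ae_ball_iff hfin'.countable]
    intro y _
    refine measure_mono_null (fun z hz => ?_) (Measure.addHaar_sphere volume x (dist x y))
    rw [Metric.mem_sphere, dist_comm]
    exact (not_not.1 hz).symm
  filter_upwards [hsph] with z hz
  -- The `6` is `3` for the width of the zone plus `3` for replacing points by corners.
  have hev : ∀ᶠ m in Filter.atTop, ∀ x ∈ insert 0 (P ω ∩ Metric.ball 0 (L : ℝ)),
      ∀ y ∈ insert 0 (P ω ∩ Metric.ball 0 (L : ℝ)), 6 * gridMesh d m < |dist x y - dist x z| := by
    rw [Filter.eventually_all_finite hfin']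
    intro x hx
    rw [Filter.eventually_all_finite hfin']
    intro y hy
    have h := (tendsto_gridMesh d).const_mul 6
    rw [mul_zero] at h
    exact h.eventually_lt_const (abs_pos.2 (sub_ne_zero.2 (hz x hx y hy)))
  filter_upwards [hev] with m hm
  refine iff_of_false ?_ (Set.notMem_empty z)
  rintro ⟨-, hzt⟩
  simp only [Set.mem_iUnion, Set.mem_ofPred_eq, exists_prop] at hzt
  obtain ⟨x', hx', y', hy', hle⟩ := hzt
  obtain ⟨x, hx, hxd⟩ := exists_near_of_mem_gridCorners hx'
  obtain ⟨y, hy, hyd⟩ := exists_near_of_mem_gridCorners hy'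
  have h1 := abs_dist_sub_dist_sub_le x y z x' y' hxd hyd
  have h2 := hm x hx y hy
  have h3 := abs_add_le ((dist x y - dist x z) - (dist x' y' - dist x' z))
    (dist x' y' - dist x' z)
  rw [sub_add_cancel] at h3
  linarith

/-- Almost surely no red point is at the same distance as a black point from a third black
point. -/
lemma ae_dist_ne_dist [MeasurableSpace Ω] {μ : Measure Ω} [IsProbabilityMeasure μ]
    {P' : Ω → Set (EuclideanSpace ℝ (Fin d))} (hd : 1 ≤ d) {c c' : ℝ≥0}
    (hP : IsPoissonProcess μ P c) (hP' : IsPoissonProcess μ P' c') (hindep : IndepPoints μ P P') :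
    ∀ᵐ ω ∂μ, ∀ x ∈ insert 0 (P ω), ∀ y ∈ insert 0 (P ω), ∀ z ∈ P' ω, dist x y ≠ dist x z := by
  have hle : pointSigma P ≤ ‹MeasurableSpace Ω› :=
    iSup₂_le fun B hB => (hP.measurable_count B hB).comap_le
  have key (L : ℕ) : ∀ᵐ ω ∂μ, ∀ x ∈ insert 0 (P ω), ∀ y ∈ insert 0 (P ω), ∀ z ∈ P' ω,
      x ∈ Metric.ball 0 (L : ℝ) → y ∈ Metric.ball 0 (L : ℝ) → z ∈ Metric.ball 0 (L : ℝ) →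
        dist x y ≠ dist x z := by
    set tie : Set Ω := {ω | ¬ ∀ x ∈ insert 0 (P ω), ∀ y ∈ insert 0 (P ω), ∀ z ∈ P' ω,
      x ∈ Metric.ball 0 (L : ℝ) → y ∈ Metric.ball 0 (L : ℝ) → z ∈ Metric.ball 0 (L : ℝ) →
        dist x y ≠ dist x z} with htie
    have hJ (m : ℕ) (J : Finset (GridIndex d L m)) : MeasurableSet {ω | hitCells P L m ω = J} :=
      hle _ (measurableSet_hitCells_eq L m J)
    have hsum (m : ℕ) (ω : Ω) : volume (tieZone (hitCells P L m ω)) =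
        ∑ J : Finset (GridIndex d L m),
          {ω | hitCells P L m ω = J}.indicator (fun _ => volume (tieZone J)) ω := by
      rw [Finset.sum_eq_single (hitCells P L m ω) (fun J _ hne => by
        rw [Set.indicator_of_notMem]; exact fun h => hne h.symm) (by simp)]
      rw [Set.indicator_of_mem]
      rfl
    have hbound (m : ℕ) : μ tie ≤ c' * ∫⁻ ω, volume (tieZone (hitCells P L m ω)) ∂μ := by
      -- Given `hitCells P L m ω = J` the tie zone is a deterministic set, and the red count on it
      -- is independent of that event.
      have hsub : tie ⊆ ⋃ J : Finset (GridIndex d L m),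
          {ω | hitCells P L m ω = J} ∩ {ω | pointCount P' (tieZone J) ω ≠ 0} := by
        intro ω hω
        simp only [htie, Set.mem_ofPred_eq, not_forall, not_not] at hω
        obtain ⟨x, hx, y, hy, z, hz, hxL, hyL, hzL, h⟩ := hω
        refine Set.mem_iUnion.2 ⟨_, rfl, ?_⟩
        obtain ⟨x', hx', hxd⟩ := exists_near_mem_gridCorners m hx hxL
        obtain ⟨y', hy', hyd⟩ := exists_near_mem_gridCorners m hy hyL
        have h1 := abs_dist_sub_dist_sub_le x y z x' y' hxd hyd
        rw [h, sub_self, zero_sub, abs_neg] at h1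
        have : z ∈ P' ω ∩ tieZone (hitCells P L m ω) := by
          refine ⟨hz, hzL, ?_⟩
          simp only [Set.mem_iUnion, Set.mem_ofPred_eq, exists_prop]
          exact ⟨x', hx', y', hy', h1⟩
        simpa [pointCount, ← Set.nonempty_iff_ne_empty] using ⟨z, this⟩
      calc μ tie ≤ ∑ J : Finset (GridIndex d L m),
            μ ({ω | hitCells P L m ω = J} ∩ {ω | pointCount P' (tieZone J) ω ≠ 0}) :=
            (measure_mono hsub).trans (measure_iUnion_fintype_le μ _)
        _ ≤ ∑ J : Finset (GridIndex d L m),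
            c' * (volume (tieZone J) * μ {ω | hitCells P L m ω = J}) := by
            refine Finset.sum_le_sum fun J _ => ?_
            refine ((Indep_iff _ _ μ).1 hindep _ _ (measurableSet_hitCells_eq L m J)
              (measurable_pointCount_pointSigma P' (measurableSet_tieZone J)
                (measurableSet_singleton 0).compl)).trans_le ?_
            rw [mul_comm, ← mul_assoc]
            gcongr
            exact hP'.measure_count_ne_zero_le (measurableSet_tieZone J)
              ((volume_tieZone_le J).trans_lt measure_ball_lt_top).ne
        _ = _ := by
            simp_rw [hsum]
            rw [lintegral_finsetSum _ fun J _ => measurable_const.indicator (hJ m J),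
              Finset.mul_sum]
            simp_rw [lintegral_indicator_const (hJ m _)]
    have hlim : Filter.Tendsto (fun m => ∫⁻ ω, volume (tieZone (hitCells P L m ω)) ∂μ)
        Filter.atTop (nhds 0) := by
      have := tendsto_lintegral_of_dominated_convergence (μ := μ)
        (F := fun m ω => volume (tieZone (hitCells P L m ω))) (f := fun _ => 0)
        (fun _ => volume (Metric.ball (0 : EuclideanSpace ℝ (Fin d)) (L : ℝ))) (fun m => ?_)
        (fun m => .of_forall fun ω => volume_tieZone_le _) ?_ ?_
      · simpa using this
      · simp_rw [hsum]
        exact Finset.measurable_sum _ fun J _ => measurable_const.indicator (hJ m J)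
      · simpa using measure_ball_lt_top.ne
      · filter_upwards [hP.ae_finite (measurableSet_ball (x := 0) (ε := (L : ℝ)))
          measure_ball_lt_top.ne] with ω hω
        exact tendsto_volume_tieZone hd L hω
    have hlim' := ENNReal.Tendsto.const_mul (a := (c' : ℝ≥0∞)) hlim (Or.inr ENNReal.coe_ne_top)
    rw [mul_zero] at hlim'
    exact nonpos_iff_eq_zero.1 (ge_of_tendsto' hlim' hbound)
  filter_upwards [ae_all_iff.2 key] with ω hω x hx y hy z hz
  obtain ⟨L, hL⟩ := exists_nat_gt (max (max ‖x‖ ‖y‖) ‖z‖)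
  simp only [max_lt_iff] at hL
  exact hω L x hx y hy z hz (mem_ball_zero_iff.2 hL.1.1) (mem_ball_zero_iff.2 hL.1.2)
    (mem_ball_zero_iff.2 hL.2)

end Ties

/-! ### Survival of the discretised exploration -/

section Survival

/-- A Fatou-type bound. Continuity along increasing unions needs no measurability, so the
percolation and survival events need not be shown measurable. -/
lemma measure_le_of_ae_eventually {Ω : Type*} [MeasurableSpace Ω] {μ : Measure Ω} {E : Set Ω}
    {A : ℕ → Set Ω} {c : ℝ≥0∞} (h : ∀ᵐ ω ∂μ, ω ∈ E → ∀ᶠ k in Filter.atTop, ω ∈ A k)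
    (hA : ∀ k, μ (A k) ≤ c) : μ E ≤ c := by
  have hmono : Monotone fun n => ⋂ k ≥ n, A k := fun n n' hn =>
    Set.iInter₂_mono' fun k hk => ⟨k, hn.trans hk, subset_rfl⟩
  calc μ E ≤ μ (⋃ n, ⋂ k ≥ n, A k) := by
        refine measure_mono_ae ?_
        filter_upwards [h] with ω hω hE
        obtain ⟨n, hn⟩ := Filter.eventually_atTop.1 (hω hE)
        exact Set.mem_iUnion.2 ⟨n, Set.mem_iInter₂.2 hn⟩
    _ = ⨆ n, μ (⋂ k ≥ n, A k) := hmono.measure_iUnion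
    _ ≤ c := iSup_le fun n => (measure_mono (Set.iInter₂_subset n le_rfl)).trans (hA n)

variable {Ω : Type*} {d : ℕ} {P P' : Ω → Set (EuclideanSpace ℝ (Fin d))}

/-- The event that the numbers of black and red points in the cell `i` are those prescribed by the
state `a`. -/
def siteState (P P' : Ω → Set (EuclideanSpace ℝ (Fin d))) (L m : ℕ) (i : GridIndex d L m)
    (a : Option Bool) : Set Ω :=
  pointCount P (gridCell L m i) ⁻¹' {((if a = some true then 1 else 0 : ℕ) : ℕ∞)} ∩
    pointCount P' (gridCell L m i) ⁻¹' {((if a = some false then 1 else 0 : ℕ) : ℕ∞)}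

/-- The distances between the corners of the cells, and from the origin to them. -/
noncomputable def gridDist (L m : ℕ) (x : Option (GridIndex d L m)) (j : GridIndex d L m) : ℝ :=
  dist (x.elim 0 fun i : GridIndex d L m => gridPoint m i) (gridPoint m (j : Fin d → ℤ))

/-- The event that all cells have at most one point and their configuration survives. -/
def survivalEvent (P P' : Ω → Set (EuclideanSpace ℝ (Fin d))) (N L m : ℕ) : Set Ω :=
  {ω | ∃ s : GridIndex d L m → Option Bool,
    (∀ i, ω ∈ siteState P P' L m i (s i)) ∧ Survives (gridDist L m) N s}

lemma measure_survivalEvent_le [MeasurableSpace Ω] {μ : Measure Ω} [IsProbabilityMeasure μ]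
    {lam : ℝ≥0} (hP : IsPoissonProcess μ P 1) (hP' : IsPoissonProcess μ P' lam)
    (hindep : IndepPoints μ P P') (N L m : ℕ) :
    μ (survivalEvent P P' N L m) ≤ ENNReal.ofReal (walkSurvival lam N 1) := by
  classical
  refine (ENNReal.le_ofReal_iff_toReal_le (measure_ne_top _ _) (walkSurvival_nonneg lam.2 _ _)).2 ?_
  set p : GridIndex d L m → ℕ → ℝ := fun i k =>
    μ.real (pointCount P (gridCell L m i) ⁻¹' {(k : ℕ∞)}) with hp
  set q : GridIndex d L m → ℕ → ℝ := fun i k =>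
    μ.real (pointCount P' (gridCell L m i) ⁻¹' {(k : ℕ∞)}) with hq
  set v : GridIndex d L m → ℝ≥0 := fun i => (volume (gridCell L m (i : Fin d → ℤ))).toNNReal
  have hpv (i k) : p i k = Real.exp (-(v i : ℝ)) * (v i : ℝ) ^ k / k.factorial := by
    simp only [hp, Measure.real]
    rw [hP.measure_count_eq (measurableSet_gridCell _ _ _)
      (volume_gridCell_ne_top _ _ _), one_mul]
    exact poissonMeasure_real_singleton _ _
  have hqv (i k) : q i k = Real.exp (-(lam * v i : ℝ)) * (lam * v i : ℝ) ^ k / k.factorial := by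
    simp only [hq, Measure.real]
    rw [hP'.measure_count_eq (measurableSet_gridCell _ _ _)
      (volume_gridCell_ne_top _ _ _)]
    refine (poissonMeasure_real_singleton (lam * v i) k).trans ?_
    rw [NNReal.coe_mul]
  refine measureReal_survives_le μ lam.2 (gridDist L m) (siteState P P' L m)
    (fun i a => p i (if a = some true then 1 else 0) * q i (if a = some false then 1 else 0))
    (fun Q t => ?_) (fun i a => by positivity) (fun i => ?_) (fun i => ?_) N
  · have := measure_biInter_counts_eq_prod hP hP' hindep
      (fun i : GridIndex d L m => gridCell L m i) (fun i => measurableSet_gridCell _ _ _)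
      (fun i j hij => disjoint_gridCell _ _ (Subtype.coe_injective.ne hij)) Q
      (fun i => ((if t i = some true then 1 else 0 : ℕ) : ℕ∞))
      (fun i => ((if t i = some false then 1 else 0 : ℕ) : ℕ∞))
    simp only [siteState, Measure.real, hp, hq]
    rw [this, ENNReal.toReal_prod]
    simp only [ENNReal.toReal_mul]
  -- The three weights add up to `exp (-r) * (1 + r)` with `r = v i + lam * v i`; the deficit is the
  -- probability of two or more points in the cell.
  · have hexp := Real.add_one_le_exp ((v i : ℝ) + lam * v i)
    have hpos := Real.exp_pos (-((v i : ℝ) + lam * v i))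
    have h1 := mul_le_mul_of_nonneg_left hexp hpos.le
    rw [← Real.exp_add, neg_add_cancel, Real.exp_zero, neg_add, Real.exp_add] at h1
    simp [hpv, hqv]
    linarith
  · simp [hpv, hqv]
    ring

/-- The points that can be reached from the origin in the secrecy graph by a path in the ball of
radius `L`. -/
def reachableInBall (V R : Set (EuclideanSpace ℝ (Fin d))) (L : ℕ) (r : V) : Set V :=
  {v | Relation.ReflTransGen (fun x y => (secrecyGraph V R).Adj x y ∧
    (y : EuclideanSpace ℝ (Fin d)) ∈ Metric.ball 0 (L : ℝ)) r v}

/-- Each tree vertex has a finite path from the root, and finitely many such paths fit in one ball.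
-/
lemma HasInfiniteOutComponent.eventually_exists_finset {V R : Set (EuclideanSpace ℝ (Fin d))}
    {r : V} (h : HasInfiniteOutComponent (secrecyGraph V R) r) (n : ℕ) :
    ∀ᶠ L in Filter.atTop, ∃ F : Finset V, F.card = n ∧ ∀ v ∈ F, v ∈ reachableInBall V R L r := by
  obtain ⟨S, H, hS, hH, -, T, hTH, hT⟩ := h
  obtain ⟨F, hFS, hF⟩ := hS.exists_subset_card_eq n
  have : ∀ᶠ L in Filter.atTop, ∀ v ∈ F, v ∈ reachableInBall V R L r := by
    rw [Filter.eventually_all_finset]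
    intro v hv
    have hvT := hT.reach v (hFS hv)
    clear hv
    induction hvT with
    | refl => exact .of_forall fun L => .refl
    | @tail x y _ hxy ih =>
      filter_upwards [ih, tendsto_natCast_atTop_atTop.eventually_gt_atTop
        ‖(y : EuclideanSpace ℝ (Fin d))‖] with L hL hy
      exact hL.tail ⟨hH _ _ (hTH _ _ hxy), mem_ball_zero_iff.2 hy⟩
  exact this.mono fun L hL => ⟨F, hF, hL⟩

lemma encard_inter_gridCell_eq_one {L m : ℕ} {Z : Set (EuclideanSpace ℝ (Fin d))}
    (hinj : Set.InjOn (gridIndex m) (Z ∩ Metric.ball 0 (L : ℝ))) {x : EuclideanSpace ℝ (Fin d)}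
    (hx : x ∈ Z ∩ Metric.ball 0 (L : ℝ)) : (Z ∩ gridCell L m (gridIndex m x)).encard = 1 := by
  rw [Set.encard_eq_one]
  refine ⟨x, Set.eq_singleton_iff_unique_mem.2 ⟨⟨hx.1, hx.2, rfl⟩, fun y hy => ?_⟩⟩
  exact hinj ⟨hy.1, hy.2.1⟩ hx hy.2.2

lemma encard_inter_gridCell_eq_zero {L m : ℕ} {Z : Set (EuclideanSpace ℝ (Fin d))}
    {k : Fin d → ℤ} (h : ∀ x ∈ Z ∩ Metric.ball 0 (L : ℝ), gridIndex m x ≠ k) :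
    (Z ∩ gridCell L m k).encard = 0 := by
  rw [Set.encard_eq_zero, Set.eq_empty_iff_forall_notMem]
  exact fun x hx => h x ⟨hx.1, hx.2.1⟩ hx.2.2

/-- On a sufficiently fine grid every cell has at most one point. -/
lemma exists_siteState {L m : ℕ} {ω : Ω}
    (hinj : Set.InjOn (gridIndex m) ((P ω ∪ P' ω) ∩ Metric.ball 0 (L : ℝ)))
    (hdisj : Disjoint (P ω) (P' ω)) :
    ∃ s : GridIndex d L m → Option Bool, (∀ i, ω ∈ siteState P P' L m i (s i)) ∧
      (∀ i : GridIndex d L m, ∀ x ∈ P ω ∩ Metric.ball 0 (L : ℝ), gridIndex m x = i → s i = some true) ∧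
      ∀ i : GridIndex d L m, s i = some false → ∃ z ∈ P' ω ∩ Metric.ball 0 (L : ℝ), gridIndex m z = i := by
  classical
  have hinj₁ := hinj.mono (Set.inter_subset_inter_left _ (Set.subset_union_left))
  have hinj₂ := hinj.mono (Set.inter_subset_inter_left _ (Set.subset_union_right))
  have hne : ∀ x ∈ P ω ∩ Metric.ball 0 (L : ℝ), ∀ z ∈ P' ω ∩ Metric.ball 0 (L : ℝ),
      gridIndex m z ≠ gridIndex m x := fun x hx z hz h =>
    Set.disjoint_left.1 hdisj hx.1
      (hinj ⟨Or.inr hz.1, hz.2⟩ ⟨Or.inl hx.1, hx.2⟩ h ▸ hz.1)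
  refine ⟨fun i : GridIndex d L m => if ∃ x ∈ P ω ∩ Metric.ball 0 (L : ℝ), gridIndex m x = i then some true else
    if ∃ z ∈ P' ω ∩ Metric.ball 0 (L : ℝ), gridIndex m z = i then some false else none,
    fun i => ?_, fun i x hx hxi => if_pos ⟨x, hx, hxi⟩, fun i hi => ?_⟩
  · beta_reduce
    by_cases h1 : ∃ x ∈ P ω ∩ Metric.ball 0 (L : ℝ), gridIndex m x = i
    · rw [if_pos h1]
      obtain ⟨x, hx, hxi⟩ := h1
      simp only [siteState, pointCount, Set.mem_inter_iff, Set.mem_preimage, ← hxi,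
        encard_inter_gridCell_eq_one hinj₁ hx, encard_inter_gridCell_eq_zero (hne x hx)]
      simp
    · rw [if_neg h1]
      push Not at h1
      by_cases h2 : ∃ z ∈ P' ω ∩ Metric.ball 0 (L : ℝ), gridIndex m z = i
      · rw [if_pos h2]
        obtain ⟨z, hz, hzi⟩ := h2
        rw [← hzi] at h1
        simp only [siteState, pointCount, Set.mem_inter_iff, Set.mem_preimage, ← hzi,
          encard_inter_gridCell_eq_one hinj₂ hz, encard_inter_gridCell_eq_zero h1]
        simp
      · rw [if_neg h2]
        push Not at h2
        simp only [siteState, pointCount, Set.mem_inter_iff, Set.mem_preimage,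
          encard_inter_gridCell_eq_zero h1, encard_inter_gridCell_eq_zero h2]
        simp
  · beta_reduce at hi
    by_contra h2
    rw [if_neg h2] at hi
    split_ifs at hi
    simp at hi

/-- A fine grid separates the finitely many points in the ball and keeps strict inequalities between
their distances. If an exploration `Q` had no active site, every edge out of an explored black point
to a point of the ball would end in `Q`. Then `Q` would hold all of `F` but the root, too many for
`N` occupied sites. -/
lemma eventually_mem_survivalEvent {ω : Ω} {N L : ℕ}
    (hfin : (P ω ∩ Metric.ball 0 (L : ℝ)).Finite)
    (hfin' : (P' ω ∩ Metric.ball 0 (L : ℝ)).Finite)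
    (htie : ∀ x ∈ insert 0 (P ω), ∀ y ∈ insert 0 (P ω), ∀ z ∈ P' ω, dist x y ≠ dist x z)
    {F : Finset (insert 0 (P ω) : Set (EuclideanSpace ℝ (Fin d)))} (hF : F.card = N + 2)
    (hreach : ∀ v ∈ F, v ∈ reachableInBall (insert 0 (P ω)) (P' ω) L ⟨0, Set.mem_insert 0 (P ω)⟩) :
    ∀ᶠ m in Filter.atTop, ω ∈ survivalEvent P P' N L m := by
  classical
  -- A point of both colours would be a tie seen from the origin.
  have hdisj : Disjoint (P ω) (P' ω) := Set.disjoint_left.2 fun x hx hx' =>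
    htie 0 (Set.mem_insert _ _) x (Or.inr hx) x hx' rfl
  have hinj : ∀ᶠ m in Filter.atTop,
      Set.InjOn (gridIndex m) ((P ω ∪ P' ω) ∩ Metric.ball 0 (L : ℝ)) := by
    have hfin₂ : ((P ω ∪ P' ω) ∩ Metric.ball 0 (L : ℝ)).Finite := by
      rw [Set.union_inter_distrib_right]
      exact hfin.union hfin'
    refine (Filter.eventually_all_finite hfin₂).2 fun x hx => ?_
    suffices ∀ᶠ m in Filter.atTop, ∀ y ∈ (P ω ∪ P' ω) ∩ Metric.ball 0 (L : ℝ),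
        gridIndex m x = gridIndex m y → x = y from this.mono fun m hm y hy => hm y hy
    refine (Filter.eventually_all_finite hfin₂).2 fun y hy => ?_
    by_cases hxy : x = y
    · exact .of_forall fun _ _ => hxy
    · filter_upwards [((tendsto_gridPoint_gridIndex x).dist
        (tendsto_gridPoint_gridIndex y)).eventually_const_lt (dist_pos.2 hxy)] with m hm h
      exact absurd (congrArg (gridPoint m) h) (dist_pos.1 hm)
  have hord : ∀ᶠ m in Filter.atTop, ∀ x ∈ P ω ∩ Metric.ball 0 (L : ℝ),
      ∀ y ∈ P ω ∩ Metric.ball 0 (L : ℝ), ∀ z ∈ P' ω ∩ Metric.ball 0 (L : ℝ),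
      dist x y < dist x z → dist (gridPoint m (gridIndex m x)) (gridPoint m (gridIndex m y)) <
        dist (gridPoint m (gridIndex m x)) (gridPoint m (gridIndex m z)) := by
    refine (Filter.eventually_all_finite hfin).2 fun x _ =>
      (Filter.eventually_all_finite hfin).2 fun y _ =>
      (Filter.eventually_all_finite hfin').2 fun z _ => Filter.eventually_imp_distrib_left.2 ?_
    exact fun h => ((tendsto_gridPoint_gridIndex x).dist
      (tendsto_gridPoint_gridIndex y)).eventually_lt
      ((tendsto_gridPoint_gridIndex x).dist (tendsto_gridPoint_gridIndex z)) h
  have hord₀ : ∀ᶠ m in Filter.atTop, ∀ y ∈ P ω ∩ Metric.ball 0 (L : ℝ),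
      ∀ z ∈ P' ω ∩ Metric.ball 0 (L : ℝ), dist 0 y < dist 0 z →
        dist 0 (gridPoint m (gridIndex m y)) < dist 0 (gridPoint m (gridIndex m z)) := by
    refine (Filter.eventually_all_finite hfin).2 fun y _ =>
      (Filter.eventually_all_finite hfin').2 fun z _ => Filter.eventually_imp_distrib_left.2 ?_
    exact fun h => (tendsto_const_nhds.dist (tendsto_gridPoint_gridIndex y)).eventually_lt
      (tendsto_const_nhds.dist (tendsto_gridPoint_gridIndex z)) h
  filter_upwards [hinj, hord, hord₀] with m hinj hord hord₀
  obtain ⟨s, hs, hblack, hred⟩ := exists_siteState hinj hdisj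
  have hcount (Q : Finset (GridIndex d L m)) (hQ : ∀ v ∈ F, (v : EuclideanSpace ℝ (Fin d)) = 0 ∨
      (v : EuclideanSpace ℝ (Fin d)) ∈ P ω ∩ Metric.ball 0 (L : ℝ) ∧ ∃ i ∈ Q,
        gridIndex m (v : EuclideanSpace ℝ (Fin d)) = i) :
      N + 1 ≤ (occupiedSites s Q).card := by
    set F' := F.erase ⟨0, Set.mem_insert 0 (P ω)⟩ with hF'
    have hF₂ (v : (insert 0 (P ω) : Set (EuclideanSpace ℝ (Fin d)))) (hv : v ∈ F') :
        (v : EuclideanSpace ℝ (Fin d)) ∈ P ω ∩ Metric.ball 0 (L : ℝ) ∧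
          ∃ i ∈ Q, gridIndex m (v : EuclideanSpace ℝ (Fin d)) = i :=
      (hQ v (Finset.mem_of_mem_erase hv)).resolve_left fun h =>
        Finset.ne_of_mem_erase hv (Subtype.ext h)
    -- The root is not a site, so `N + 2` vertices leave `N + 1`, one more than `Q` may hold.
    have hcard : N + 1 ≤ F'.card := by
      have : F.card - 1 ≤ F'.card := Finset.pred_card_le_card_erase
      omega
    have himg : F'.image (fun v : (insert 0 (P ω) : Set (EuclideanSpace ℝ (Fin d))) => gridIndex m v.1) ⊆
        (occupiedSites s Q).image (fun i : GridIndex d L m => i.1) := by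
      intro k hk
      obtain ⟨v, hv, rfl⟩ := Finset.mem_image.1 hk
      obtain ⟨hvP, i, hi, hvi⟩ := hF₂ v hv
      refine Finset.mem_image.2 ⟨i, Finset.mem_filter.2 ⟨hi, ?_⟩, hvi.symm⟩
      simp [hblack i v hvP hvi]
    have hinjF : Set.InjOn (fun v : (insert 0 (P ω) : Set (EuclideanSpace ℝ (Fin d))) =>
        gridIndex m v.1) F' := fun v hv v' hv' h =>
      Subtype.ext (hinj ⟨Or.inl (hF₂ v hv).1.1, (hF₂ v hv).1.2⟩
        ⟨Or.inl (hF₂ v' hv').1.1, (hF₂ v' hv').1.2⟩ h)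
    calc N + 1 ≤ F'.card := hcard
      _ = _ := (Finset.card_image_of_injOn hinjF).symm
      _ ≤ _ := Finset.card_le_card himg
      _ ≤ _ := Finset.card_image_le
  have hreachP : ∀ v ∈ reachableInBall (insert 0 (P ω)) (P' ω) L ⟨0, Set.mem_insert 0 (P ω)⟩,
      (v : EuclideanSpace ℝ (Fin d)) = 0 ∨
        (v : EuclideanSpace ℝ (Fin d)) ∈ P ω ∩ Metric.ball 0 (L : ℝ) := by
    intro v hv
    rcases Relation.ReflTransGen.cases_tail hv with rfl | ⟨_, _, hv⟩
    · exact Or.inl rfl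
    · exact v.2.imp_right fun h => ⟨h, hv.2⟩
  refine ⟨s, hs, ?_, fun Q hQ => ?_⟩
  · refine (Nat.le_succ N).trans (hcount _ fun v hv => (hreachP v (hreach v hv)).imp_right
      fun h => ⟨h, ⟨_, Set.mem_image_of_mem _ h.2⟩, Finset.mem_univ _, rfl⟩)
  by_contra hempty
  rw [Finset.not_nonempty_iff_eq_empty] at hempty
  have hretired (x : Option (GridIndex d L m)) (hx : ∀ i, x = some i → i ∈ Q ∧ s i = some true) :
      IsRetired (gridDist L m) s Q x := by
    by_contra h
    exact Finset.notMem_empty x (hempty ▸ mem_activeSites.2 ⟨hx, h⟩)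
  have hQreach : ∀ v ∈ reachableInBall (insert 0 (P ω)) (P' ω) L ⟨0, Set.mem_insert 0 (P ω)⟩,
      (v : EuclideanSpace ℝ (Fin d)) = 0 ∨
        (v : EuclideanSpace ℝ (Fin d)) ∈ P ω ∩ Metric.ball 0 (L : ℝ) ∧
          ∃ i ∈ Q, gridIndex m (v : EuclideanSpace ℝ (Fin d)) = i := by
    intro v hv
    induction hv with
    | refl => exact Or.inl rfl
    | @tail x y hx hxy ih =>
      refine y.2.imp_right fun hyP => ⟨⟨hyP, hxy.2⟩, ⟨_, Set.mem_image_of_mem _ hxy.2⟩, ?_, rfl⟩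
      -- The open ball in the edge relation gives only `≤`; the absence of ties makes it strict,
      -- hence visible on the grid.
      have hcloser : ∀ z ∈ P' ω, dist x.1 y.1 < dist x.1 z := by
        intro z hz
        refine lt_of_le_of_ne ?_ (htie x x.2 y y.2 z hz)
        have := hxy.1.2 z hz
        rw [Metric.mem_ball, not_lt, ← dist_eq_norm, dist_comm z] at this
        exact this
      rcases ih with hx0 | ⟨hxP, i, hiQ, hxi⟩
      · obtain ⟨z, hzQ, hz, hy⟩ := hretired none (by simp)
        obtain ⟨z', hz', hzz'⟩ := hred z hz
        refine hy _ ?_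
        rw [hx0] at hcloser
        have := hord₀ y ⟨hyP, hxy.2⟩ z' hz' (hcloser z' hz'.1)
        rw [hzz'] at this
        exact this
      · obtain ⟨z, hzQ, hz, hy⟩ := hretired (some i) (by
          rintro _ ⟨⟩
          exact ⟨hiQ, hblack i x hxP hxi⟩)
        obtain ⟨z', hz', hzz'⟩ := hred z hz
        refine hy _ ?_
        have := hord x hxP y ⟨hyP, hxy.2⟩ z' hz' (hcloser z' hz'.1)
        rw [hzz', hxi] at this
        exact this
  exact absurd (hcount Q fun v hv => hQreach v (hreach v hv)) (by omega)

end Survival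

theorem proposition3 {Ω : Type*} [MeasurableSpace Ω] (μ : Measure Ω) [IsProbabilityMeasure μ]
    (d : ℕ) (hd : 1 ≤ d) (lam : ℝ≥0)
    (P P' : Ω → Set (EuclideanSpace ℝ (Fin d)))
    (hP : IsPoissonProcess μ P 1) (hP' : IsPoissonProcess μ P' lam)
    (hindep : IndepPoints μ P P') :
    outPercolationProb μ P P' ≤ max 0 (1 - (lam : ℝ)) := by
  refine le_max_of_forall_le_walkSurvival lam.2 fun N => ?_
  refine ENNReal.toReal_le_of_le_ofReal (walkSurvival_nonneg lam.2 _ _) ?_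
  have hball (L : ℕ) : volume (Metric.ball (0 : EuclideanSpace ℝ (Fin d)) (L : ℝ)) ≠ ∞ :=
    measure_ball_lt_top.ne
  -- The outer limit is over the radius `L`, the inner one over the mesh `m` at fixed `L`.
  refine measure_le_of_ae_eventually
    (A := fun L => {ω | ∀ᶠ m in Filter.atTop, ω ∈ survivalEvent P P' N L m}) ?_ fun L =>
      measure_le_of_ae_eventually (.of_forall fun ω hω => hω)
        (measure_survivalEvent_le hP hP' hindep N L)
  filter_upwards [ae_all_iff.2 fun L : ℕ => hP.ae_finite measurableSet_ball (hball L),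
    ae_all_iff.2 fun L : ℕ => hP'.ae_finite measurableSet_ball (hball L),
    ae_dist_ne_dist hd hP hP' hindep] with ω hfin hfin' htie hω
  filter_upwards [HasInfiniteOutComponent.eventually_exists_finset hω (N + 2)] with L hL
  obtain ⟨F, hF, hreach⟩ := hL
  exact eventually_mem_survivalEvent (hfin L) (hfin' L) htie hF hreach
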